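/- Let $n\ge 3$ and label the vertices of a convex $(n+4)$-gon cyclically by $\mathbb{Z}_{n+4}$. In a triangulation of the polygon without extra vertices, the sides of the polygon are called external edges and all other edges are called internal edges, or chords; the triangulation has $n+1$ chords. It is called inner-triangle-free if none of its triangles has three internal edges. A chord is short if it joins the vertices $i-1$ and $i+1$ for some $i\in\mathbb{Z}_{n+4}$. A proper coloring of an inner-triangle-free triangulation is a labeling of its chords by $0,1,\dots,n$, each label being used once, obtained as follows: some short chord is labeled $0$; then, inductively, a not yet labeled chord contained in a triangle whose other chord is labeled $i$ is labeled $i+1$. Flipping a chord means replacing it by the other diagonal of the quadrangle formed by the two triangles containing it; in a colored triangulation the new chord inherits the label of the old one and all other chords keep their labels. The colored flip graph $\Gamma_n$ is the graph whose nodes are the inner-triangle-free triangulations of the polygon equipped with a proper coloring, two of them being joined by an arc colored $i$ if one is obtained from the other by a flip of the chord labeled $i$. Theorem. For every $n\ge 3$, the graph $\Gamma_n$ is connected and its diameter (the largest distance, i.e. number of arcs in a shortest path, between two nodes) is $$\operatorname{Diam}(\Gamma_n)=\frac{(n+1)(n+4)}{2}.$$ -/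

import Mathlib

namespace TriangleFree

/-- The vertices of a convex `(n+4)`-gon, in counterclockwise order `0, 1, …, n+3`, labeled by the
cyclic group of order `n+4`. -/
abbrev Vertex (n : ℕ) : Type := ZMod (n + 4)

/-- The external edges, i.e. the sides of the polygon. -/
def IsExternal {n : ℕ} (e : Sym2 (Vertex n)) : Prop :=
  ∃ i : Vertex n, e = s(i, i + 1)

/-- The chords (diagonals): segments joining two distinct vertices that are not sides of the
polygon. -/
def IsChord {n : ℕ} (e : Sym2 (Vertex n)) : Prop :=
  ¬ e.IsDiag ∧ ¬ IsExternal e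

/-- Going once around the polygon from `a`, one meets `b`, then `c`, then `d`, and the four
vertices are distinct. -/
def InCyclicOrder {n : ℕ} (a b c d : Vertex n) : Prop :=
  0 < (b - a).val ∧ (b - a).val < (c - a).val ∧ (c - a).val < (d - a).val

/-- Two segments between vertices of the convex polygon cross (meet in their relative interiors,
without overlapping) if their endpoints are distinct and alternate around the polygon. -/
def Crosses {n : ℕ} (e f : Sym2 (Vertex n)) : Prop :=
  ∃ a b c d : Vertex n, e = s(a, c) ∧ f = s(b, d) ∧ InCyclicOrder a b c d

/-- A triangulation without extra vertices, given by its set of internal edges: a maximal set of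
pairwise non-crossing chords. -/
def IsTriangulation {n : ℕ} (T : Set (Sym2 (Vertex n))) : Prop :=
  Maximal (fun D : Set (Sym2 (Vertex n)) =>
    (∀ e ∈ D, IsChord e) ∧ ∀ e ∈ D, ∀ f ∈ D, ¬ Crosses e f) T

/-- Edges of the triangulation `T`, external or internal. -/
def IsEdge {n : ℕ} (T : Set (Sym2 (Vertex n))) (e : Sym2 (Vertex n)) : Prop :=
  e ∈ T ∨ IsExternal e

/-- The triangles of the triangulation `T`. As the polygon is convex and has no extra vertices,
these are the triples of vertices that are pairwise joined by edges of `T`. -/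
def IsTriangle {n : ℕ} (T : Set (Sym2 (Vertex n))) (a b c : Vertex n) : Prop :=
  IsEdge T s(a, b) ∧ IsEdge T s(b, c) ∧ IsEdge T s(c, a)

/-- No triangle of `T` has three internal edges. -/
def IsInnerTriangleFree {n : ℕ} (T : Set (Sym2 (Vertex n))) : Prop :=
  ∀ a b c : Vertex n, IsTriangle T a b c → ¬ (s(a, b) ∈ T ∧ s(b, c) ∈ T ∧ s(c, a) ∈ T)

/-- A short chord joins `i - 1` and `i + 1` for some vertex `i`. -/
def IsShort {n : ℕ} (e : Sym2 (Vertex n)) : Prop :=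
  ∃ i : Vertex n, e = s(i - 1, i + 1)

/-- Proper colorings of `T`; `col i` is the chord labeled `i`. Every chord of `T` gets exactly one
of the labels `0, …, n`; the chord labeled `0` is short; and the chord labeled `i + 1` is a chord,
not among those labeled `0, …, i`, that lies in a common triangle of `T` with the chord
labeled `i`. -/
structure IsProperColoring {n : ℕ} (T : Set (Sym2 (Vertex n)))
    (col : Fin (n + 1) → Sym2 (Vertex n)) : Prop where
  range_eq : Set.range col = T
  injective : Function.Injective col
  short : IsShort (col 0)
  step : ∀ i : Fin n, ∃ a b c : Vertex n,
    IsTriangle T a b c ∧ col i.castSucc = s(a, b) ∧ col i.succ = s(b, c)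

/-- `CTFT n`: the properly colored inner-triangle-free triangulations of the convex
`(n+4)`-gon. -/
structure CTFT (n : ℕ) where
  /-- the set of chords of the triangulation -/
  chords : Set (Sym2 (Vertex n))
  isTriangulation : IsTriangulation chords
  isInnerTriangleFree : IsInnerTriangleFree chords
  /-- `col i` is the chord labeled `i` -/
  col : Fin (n + 1) → Sym2 (Vertex n)
  isProperColoring : IsProperColoring chords col

/-- `T'` is obtained from `T` by a flip of the chord labeled `i`: this chord is a diagonal of the
quadrangle `a b c d`, the union of two adjacent triangles of `T`; it is replaced by the other
diagonal, which inherits the label `i`, and all other chords keep their labels. -/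
def IsFlip {n : ℕ} (i : Fin (n + 1)) (T T' : CTFT n) : Prop :=
  ∃ a b c d : Vertex n, b ≠ d ∧ IsTriangle T.chords a b c ∧ IsTriangle T.chords a d c ∧
    T.col i = s(a, c) ∧ T'.col = Function.update T.col i s(b, d)

/-- The colored flip graph `Γ_n`: two colored triangulations are joined (by an arc colored `i`) if
one is obtained from the other by a flip of the chord labeled `i`. -/
def flipGraph (n : ℕ) : SimpleGraph (CTFT n) :=
  SimpleGraph.fromRel fun T T' => ∃ i : Fin (n + 1), IsFlip i T T'

end TriangleFree

namespace TriangleFree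

variable {n : ℕ}

/-! ### Integer representatives of the vertices -/

/-! Chord `i` of a colored triangulation cuts off an arc of `i + 2` sides, and each arc extends the
previous one by one side at one end. Lifting the initial vertices to `ℤ` therefore gives a sequence
`A 0, …, A n` whose steps are `0` or `-1`. Every such staircase encodes a colored triangulation
(`IsStaircase.toCTFT`), every colored triangulation has a lift (`exists_isLift`), and lifts are
unique up to translation by multiples of `n + 4`.

A flip changes a lift, suitably translated, by at most one in one entry (`exists_isLift_of_adj`).
Conversely, a staircase can be moved to any other one by such unit moves without detours
(`edist_le_of_stairDist_le`). So distance in the graph is the `ℓ¹` distance of lifts, minimized over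
translations.

The difference of two staircases has steps at most one, which bounds this minimum by `(n + 1)(n + 4)
/ 2` (`exists_sum_abs_sub_le`). Translating by `k` periods changes the sum of the differences by
`k(n + 1)(n + 4)`. If that sum is exactly half of `(n + 1)(n + 4)`, no translation makes it smaller
in absolute value, so the bound is attained (`le_length_of_sum_eq`). Finiteness of the extended
diameter includes connectedness. -/

lemma intCast_inj_of_lt {p q : ℤ} (h : (p : Vertex n) = q) (h₁ : p - q < n + 4)
    (h₂ : q - p < n + 4) : p = q := by
  rw [ZMod.intCast_eq_intCast_iff_dvd_sub] at h
  have := Int.eq_zero_of_abs_lt_dvd h (by rw [abs_lt]; push_cast; constructor <;> linarith)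
  linarith

lemma intCast_add_period (p : ℤ) : ((p + (n + 4) : ℤ) : Vertex n) = p := by
  rw [ZMod.intCast_eq_intCast_iff_dvd_sub]
  exact ⟨-1, by push_cast; ring⟩

lemma val_intCast_sub_of_le {p q : ℤ} (h : q ≤ p) (h' : p < q + n + 4) :
    ((((p : Vertex n) - q).val : ℕ) : ℤ) = p - q := by
  rw [← Int.cast_sub, ZMod.val_intCast]
  exact Int.emod_eq_of_lt (by linarith) (by push_cast; linarith)

lemma val_intCast_sub_of_lt {p q : ℤ} (h : p < q) (h' : q ≤ p + n + 4) :
    ((((p : Vertex n) - q).val : ℕ) : ℤ) = p - q + n + 4 := by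
  rw [← intCast_add_period p, val_intCast_sub_of_le (by linarith) (by linarith)]
  ring

/-- Every edge has integer representatives in any prescribed period. -/
lemma exists_intCast_mk (x : ℤ) {e : Sym2 (Vertex n)} (he : ¬ e.IsDiag) :
    ∃ u v : ℤ, x ≤ u ∧ u < v ∧ v ≤ x + n + 3 ∧ e = s((u : Vertex n), (v : Vertex n)) := by
  have key : ∀ w : Vertex n, ∃ u : ℤ, x ≤ u ∧ u ≤ x + n + 3 ∧ (u : Vertex n) = w := by
    intro w
    have := ZMod.val_lt (w - (x : Vertex n))
    exact ⟨x + (w - (x : Vertex n)).val, by omega, by omega, by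
      rw [Int.cast_add, Int.cast_natCast, ZMod.natCast_zmod_val]; ring⟩
  induction e with
  | _ a b =>
    obtain ⟨u, hu, hu', rfl⟩ := key a
    obtain ⟨v, hv, hv', rfl⟩ := key b
    rcases lt_trichotomy u v with h | h | h
    · exact ⟨u, v, hu, h, hv', rfl⟩
    · exact absurd (by simp [h]) he
    · exact ⟨v, u, hv, h, hu', Sym2.eq_swap⟩

lemma isExternal_intCast {p q : ℤ} (h : q = p + 1) :
    IsExternal s((p : Vertex n), (q : Vertex n)) :=
  ⟨p, by rw [h]; push_cast; rfl⟩

lemma isExternal_intCast_period (p : ℤ) :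
    IsExternal s((p : Vertex n), ((p + n + 3 : ℤ) : Vertex n)) := by
  have h := isExternal_intCast (n := n) (p := p + n + 3) rfl
  rwa [show p + n + 3 + 1 = p + (n + 4) by ring, intCast_add_period, Sym2.eq_swap] at h

lemma isChord_intCast {p q : ℤ} (h : p + 2 ≤ q) (h' : q ≤ p + n + 2) :
    IsChord s((p : Vertex n), (q : Vertex n)) := by
  constructor
  · rw [Sym2.mk_isDiag_iff]
    intro h₀
    have := intCast_inj_of_lt h₀ (by linarith) (by linarith)
    linarith
  · rintro ⟨w, hw⟩
    rw [Sym2.eq_iff] at hw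
    rcases hw with ⟨rfl, hw⟩ | ⟨hw, rfl⟩
    · have := intCast_inj_of_lt (p := q) (q := p + 1) (by push_cast; exact hw) (by linarith)
        (by linarith)
      linarith
    · have := intCast_inj_of_lt (p := p) (q := q + 1 - (n + 4))
        (by rw [← intCast_add_period (q + 1 - (n + 4))]; push_cast; rw [hw]; ring)
        (by linarith) (by linarith)
      linarith

lemma crosses_intCast {a b c d : ℤ} (hab : a < b) (hbc : b < c) (hcd : c < d)
    (hda : d < a + n + 4) :
    Crosses s((a : Vertex n), (c : Vertex n)) s((b : Vertex n), (d : Vertex n)) := by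
  refine ⟨a, b, c, d, rfl, rfl, ?_⟩
  have h₁ := val_intCast_sub_of_le (n := n) (p := b) (q := a) (by omega) (by omega)
  have h₂ := val_intCast_sub_of_le (n := n) (p := c) (q := a) (by omega) (by omega)
  have h₃ := val_intCast_sub_of_le (n := n) (p := d) (q := a) (by omega) (by omega)
  unfold InCyclicOrder
  omega

lemma InCyclicOrder.rotate {a b c d : Vertex n} (h : InCyclicOrder a b c d) :
    InCyclicOrder b c d a := by
  obtain ⟨h₁, h₂, h₃⟩ := h
  have hd := ZMod.val_lt (d - a)
  have k₁ : (c - b).val = (c - a).val - (b - a).val := by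
    rw [← sub_sub_sub_cancel_right c b a, ZMod.val_sub h₂.le]
  have k₂ : (d - b).val = (d - a).val - (b - a).val := by
    rw [← sub_sub_sub_cancel_right d b a, ZMod.val_sub (h₂.trans h₃).le]
  have k₃ : (a - b).val = n + 4 - (b - a).val := by
    have : NeZero (b - a) := ⟨fun h => by simp [h] at h₁⟩
    rw [← neg_sub b a, ZMod.val_neg_of_ne_zero]
  refine ⟨?_, ?_, ?_⟩ <;> omega

lemma Crosses.symm {e f : Sym2 (Vertex n)} (h : Crosses e f) : Crosses f e := by
  obtain ⟨a, b, c, d, rfl, rfl, h⟩ := h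
  exact ⟨b, c, d, a, rfl, Sym2.eq_swap, h.rotate⟩

lemma not_crosses_of_nested {x u v y : ℤ} (hxu : x ≤ u) (huv : u < v) (hvy : v ≤ y)
    (hyx : y < x + n + 4) :
    ¬ Crosses s((x : Vertex n), (y : Vertex n)) s((u : Vertex n), (v : Vertex n)) := by
  rintro ⟨a, b, c, d, h₁, h₂, h⟩
  wlog hb : b = (u : Vertex n) ∧ d = (v : Vertex n) generalizing a b c d
  · refine this c d a b (h₁.trans Sym2.eq_swap) (h₂.trans Sym2.eq_swap) h.rotate.rotate ?_
    rw [Sym2.eq_iff] at h₂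
    tauto
  obtain ⟨rfl, rfl⟩ := hb
  obtain ⟨k₁, k₂, k₃⟩ := h
  rw [Sym2.eq_iff] at h₁
  rcases h₁ with ⟨rfl, rfl⟩ | ⟨rfl, rfl⟩
  · have e₂ := val_intCast_sub_of_le (n := n) (p := y) (q := x) (by omega) (by omega)
    have e₃ := val_intCast_sub_of_le (n := n) (p := v) (q := x) (by omega) (by omega)
    omega
  · have e₁ := val_intCast_sub_of_lt (n := n) (p := u) (q := y) (by omega) (by omega)
    have e₂ := val_intCast_sub_of_lt (n := n) (p := x) (q := y) (by omega) (by omega)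
    omega

/-! ### Staircases and the triangulations they encode -/

/-- The lifts to `ℤ` of the sequences of initial vertices of the chords labeled `0, …, n`. -/
def IsStaircase (n : ℕ) (A : ℕ → ℤ) : Prop :=
  ∀ i < n, A (i + 1) = A i ∨ A (i + 1) = A i - 1

/-- The segment spanning `i + 2` consecutive sides of the polygon, starting at the vertex `x`. -/
def arcChord (n : ℕ) (x : ℤ) (i : ℕ) : Sym2 (Vertex n) :=
  s((x : Vertex n), ((x + i + 2 : ℤ) : Vertex n))

lemma IsStaircase.bounds {A : ℕ → ℤ} (hA : IsStaircase n A) {i j : ℕ} (hij : i ≤ j) (hj : j ≤ n) :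
    A j ≤ A i ∧ A i + i ≤ A j + j := by
  induction j, hij using Nat.le_induction with
  | base => simp
  | succ j hij ih =>
    have := ih (by omega)
    have := hA j (by omega)
    push_cast
    omega

lemma arcChord_add_period (x k : ℤ) (i : ℕ) :
    arcChord n (x + k * (n + 4)) i = arcChord n x i := by
  have key (y : ℤ) : ((y + k * (n + 4) : ℤ) : Vertex n) = y := by
    rw [ZMod.intCast_eq_intCast_iff_dvd_sub]
    exact ⟨-k, by push_cast; ring⟩
  rw [arcChord, arcChord, key, show x + k * (n + 4) + i + 2 = x + i + 2 + k * (n + 4) by ring, key]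

lemma arcChord_eq_arcChord {x y : ℤ} {i : ℕ} (h : arcChord n x i = arcChord n y i) :
    (n + 4 : ℤ) ∣ y - x ∨ ((n + 4 : ℤ) ∣ y - x + i + 2 ∧ (n + 4 : ℤ) ∣ y - x - i - 2) := by
  rw [arcChord, arcChord, Sym2.eq_iff] at h
  simp only [ZMod.intCast_eq_intCast_iff_dvd_sub, Nat.cast_add, Nat.cast_ofNat] at h
  rcases h with h | h
  · exact Or.inl h.1
  · refine Or.inr ⟨?_, ?_⟩
    · convert h.1 using 1; ring
    · convert h.2 using 1; ring

lemma isChord_arcChord (x : ℤ) {i : ℕ} (hi : i ≤ n) : IsChord (arcChord n x i) :=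
  isChord_intCast (by omega) (by omega)

namespace IsStaircase

variable {A : ℕ → ℤ}

/-- Since `A i` weakly decreases and `A i + i` weakly increases, the arcs spanned by the chords are
nested. -/
lemma not_crosses (hA : IsStaircase n A) {i j : ℕ} (hi : i ≤ n) (hj : j ≤ n) :
    ¬ Crosses (arcChord n (A i) i) (arcChord n (A j) j) := by
  wlog hij : j ≤ i generalizing i j
  · exact fun h => this hj hi (by omega) h.symm
  have := hA.bounds hij hi
  exact not_crosses_of_nested (by omega) (by omega) (by omega) (by omega)

/-- A chord inside the arc spanned by one of the chords of a staircase that crosses none of them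
is one of them. -/
lemma arcChord_mem_of_not_crosses (hA : IsStaircase n A) {e : Sym2 (Vertex n)} (he : IsChord e)
    (hc : ∀ i ≤ n, ¬ Crosses e (arcChord n (A i) i)) {i : ℕ} (hi : i ≤ n) {u v : ℤ}
    (hu : A i ≤ u) (huv : u < v) (hv : v ≤ A i + i + 2)
    (h : e = s((u : Vertex n), (v : Vertex n))) : ∃ j ≤ n, e = arcChord n (A j) j := by
  have ext₁ : v ≠ u + 1 := by
    rintro rfl
    exact he.2 (h ▸ isExternal_intCast rfl)
  induction i with
  | zero =>
    refine ⟨0, by omega, ?_⟩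
    rw [h, arcChord]
    norm_cast at *
    congr 3 <;> omega
  | succ i ih =>
    push_cast at hv
    by_cases hin : A i ≤ u ∧ v ≤ A i + i + 2
    · exact ih (by omega) hin.1 hin.2
    by_cases hnew : u = A (i + 1) ∧ v = A (i + 1) + (i + 1 : ℕ) + 2
    · exact ⟨i + 1, hi, by rw [h, arcChord, hnew.2, hnew.1]⟩
    exfalso
    push_cast at hnew
    -- The arc of chord `i + 1` has just one more side than that of chord `i`. A chord using the new
    -- vertex, other than chord `i + 1` itself, separates the ends of chord `i`.
    apply hc i (by omega)
    rw [h, arcChord]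
    rcases hA i (by omega) with hs | hs
    · exact (crosses_intCast (by omega) (by omega) (by omega) (by omega)).symm
    · exact crosses_intCast (by omega) (by omega) (by omega) (by omega)

lemma isTriangulation (hA : IsStaircase n A) :
    IsTriangulation (Set.range fun i : Fin (n + 1) => arcChord n (A i) i) := by
  refine ⟨⟨?_, ?_⟩, ?_⟩
  · rintro _ ⟨i, rfl⟩
    exact isChord_arcChord _ (by omega)
  · rintro _ ⟨i, rfl⟩ _ ⟨j, rfl⟩
    exact hA.not_crosses (by omega) (by omega)
  · intro D hD hle e he
    have hc : ∀ i ≤ n, ¬ Crosses e (arcChord n (A i) i) := fun i hi =>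
      hD.2 e he _ (hle ⟨⟨i, by omega⟩, rfl⟩)
    have hch := hD.1 e he
    obtain ⟨u, v, hu, huv, hv, h⟩ := exists_intCast_mk (A n) hch.1
    suffices ∃ j ≤ n, e = arcChord n (A j) j by
      obtain ⟨j, hj, rfl⟩ := this
      exact ⟨⟨j, by omega⟩, rfl⟩
    by_cases hv' : v ≤ A n + n + 2
    · exact hA.arcChord_mem_of_not_crosses hch hc le_rfl hu huv hv' h
    -- This is the only vertex off the last arc. Joined to either end of the last chord it gives a
    -- side; joined to any other vertex it crosses that chord.
    obtain rfl : v = A n + n + 3 := by omega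
    exfalso
    by_cases h₁ : u = A n
    · exact hch.2 (by rw [h, h₁]; exact isExternal_intCast_period _)
    by_cases h₂ : u = A n + n + 2
    · refine hch.2 (by rw [h, h₂]; exact isExternal_intCast (by ring))
    · apply hc n le_rfl
      rw [h, arcChord]
      exact (crosses_intCast (by omega) (by omega) (by omega) (by omega)).symm

/-- The vertices from the initial vertex of the last chord to that of the first. All chords join
such a vertex to one that is not. -/
def IsLeft (n : ℕ) (A : ℕ → ℤ) (w : Vertex n) : Prop :=
  ∃ p : ℤ, A n ≤ p ∧ p ≤ A 0 ∧ w = p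

lemma isLeft (hA : IsStaircase n A) {i : ℕ} (hi : i ≤ n) : IsLeft n A (A i : ℤ) :=
  ⟨A i, (hA.bounds hi le_rfl).1, (hA.bounds (Nat.zero_le i) hi).1, rfl⟩

lemma not_isLeft (hA : IsStaircase n A) {i : ℕ} (hi : i ≤ n) :
    ¬ IsLeft n A ((A i + i + 2 : ℤ) : Vertex n) := by
  rintro ⟨p, hp, hp', h⟩
  have h₁ := hA.bounds hi le_rfl
  have h₂ := hA.bounds (Nat.zero_le i) hi
  have := intCast_inj_of_lt h (by push_cast at *; omega) (by push_cast at *; omega)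
  push_cast at *
  omega

lemma isLeft_iff_not_isLeft (hA : IsStaircase n A) {x y : Vertex n}
    (h : s(x, y) ∈ Set.range fun i : Fin (n + 1) => arcChord n (A i) i) :
    IsLeft n A x ↔ ¬ IsLeft n A y := by
  obtain ⟨i, hi⟩ := h
  have h₁ := hA.isLeft (i := i) (by omega)
  have h₂ := hA.not_isLeft (i := i) (by omega)
  simp only [arcChord, Sym2.eq_iff] at hi
  rcases hi with ⟨rfl, rfl⟩ | ⟨rfl, rfl⟩ <;> tauto

/-- `IsLeft` is a proper 2-coloring of the graph formed by the chords, so three chords cannot close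
up to a triangle. -/
lemma isInnerTriangleFree (hA : IsStaircase n A) :
    IsInnerTriangleFree (Set.range fun i : Fin (n + 1) => arcChord n (A i) i) := by
  rintro a b c _ ⟨h₁, h₂, h₃⟩
  have := hA.isLeft_iff_not_isLeft h₁
  have := hA.isLeft_iff_not_isLeft h₂
  have := hA.isLeft_iff_not_isLeft h₃
  tauto

lemma arcChord_injective (hA : IsStaircase n A) :
    Function.Injective fun i : Fin (n + 1) => arcChord n (A i) i := by
  intro i j hij
  simp only [arcChord, Sym2.eq_iff] at hij
  wlog h : (i : ℕ) ≤ j generalizing i j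
  · exact (this (hij.imp (fun h => ⟨h.1.symm, h.2.symm⟩) fun h => ⟨h.2.symm, h.1.symm⟩)
      (by omega)).symm
  have hb := hA.bounds h (by omega)
  rcases hij with ⟨h₁, h₂⟩ | ⟨h₁, -⟩
  · have e₁ := intCast_inj_of_lt h₁ (by omega) (by omega)
    have e₂ := intCast_inj_of_lt h₂ (by omega) (by omega)
    omega
  · have h₂ := hA.isLeft (i := i) (by omega)
    rw [h₁] at h₂
    exact absurd h₂ (hA.not_isLeft (by omega))

lemma isProperColoring (hA : IsStaircase n A) :
    IsProperColoring (Set.range fun i : Fin (n + 1) => arcChord n (A i) i)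
      (fun i : Fin (n + 1) => arcChord n (A i) i) where
  range_eq := rfl
  injective := hA.arcChord_injective
  short := ⟨((A 0 + 1 : ℤ) : Vertex n), by
    simp only [arcChord, Fin.val_zero]
    push_cast
    rw [add_sub_cancel_right, add_zero, add_assoc _ 1 1, one_add_one_eq_two]⟩
  step i := by
    have hm (j : Fin (n + 1)) : IsEdge (Set.range fun i : Fin (n + 1) => arcChord n (A i) i)
      (arcChord n (A j) j) := Or.inl ⟨j, rfl⟩
    have h₁ := hm i.castSucc
    have h₂ := hm i.succ
    simp only [Fin.val_castSucc, Fin.val_succ, arcChord] at h₁ h₂ ⊢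
    rcases hA i i.isLt with hs | hs
    · refine ⟨((A i + i + 2 : ℤ) : Vertex n), ((A i : ℤ) : Vertex n),
        ((A i + i + 3 : ℤ) : Vertex n), ⟨Sym2.eq_swap ▸ h₁, ?_, Or.inr ?_⟩, Sym2.eq_swap, ?_⟩
      · rw [hs] at h₂
        rwa [show A i + i + 3 = A i + (i + 1 : ℕ) + 2 by push_cast; ring]
      · rw [Sym2.eq_swap]
        exact isExternal_intCast (by ring)
      · rw [hs]
        rw [show A i + (i + 1 : ℕ) + 2 = A i + i + 3 by push_cast; ring]
    · have e : A (i + 1) + (i + 1 : ℕ) + 2 = A i + i + 2 := by rw [hs]; push_cast; ring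
      rw [e] at h₂ ⊢
      refine ⟨_, _, ((A (i + 1) : ℤ) : Vertex n), ⟨h₁, Sym2.eq_swap ▸ h₂, Or.inr ?_⟩, rfl,
        Sym2.eq_swap⟩
      exact isExternal_intCast (by omega)

/-- The colored triangulation encoded by a staircase. -/
def toCTFT (hA : IsStaircase n A) : CTFT n where
  chords := Set.range fun i : Fin (n + 1) => arcChord n (A i) i
  isTriangulation := hA.isTriangulation
  isInnerTriangleFree := hA.isInnerTriangleFree
  col := fun i => arcChord n (A i) i
  isProperColoring := hA.isProperColoring

end IsStaircase

/-! ### Lifting colored triangulations to staircases -/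

lemma CTFT.ext_col {T T' : CTFT n} (h : T.col = T'.col) : T = T' := by
  have hc : T.chords = T'.chords := by
    rw [← T.isProperColoring.range_eq, ← T'.isProperColoring.range_eq, h]
  cases T
  cases T'
  simp_all

lemma CTFT.col_mem (T : CTFT n) (i : Fin (n + 1)) : T.col i ∈ T.chords :=
  T.isProperColoring.range_eq ▸ Set.mem_range_self i

/-- In an inner-triangle-free triangulation, consecutive chords share an end, and their other ends
are adjacent vertices of the polygon. -/
lemma CTFT.exists_col_eq (T : CTFT n) (i : Fin n) : ∃ a b c : Vertex n,
    T.col i.castSucc = s(a, b) ∧ T.col i.succ = s(b, c) ∧ (a = c + 1 ∨ c = a + 1) := by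
  obtain ⟨a, b, c, ht, h₁, h₂⟩ := T.isProperColoring.step i
  refine ⟨a, b, c, h₁, h₂, ?_⟩
  rcases ht.2.2 with h₃ | ⟨v, hv⟩
  · exact absurd ⟨h₁ ▸ T.col_mem _, h₂ ▸ T.col_mem _, h₃⟩ (T.isInnerTriangleFree a b c ht)
  · rw [Sym2.eq_iff] at hv
    rcases hv with ⟨rfl, rfl⟩ | ⟨rfl, rfl⟩ <;> simp

/-- The staircase `A` encodes the colored triangulation `T`. -/
def IsLift (A : ℕ → ℤ) (T : CTFT n) : Prop :=
  IsStaircase n A ∧ ∀ i : Fin (n + 1), T.col i = arcChord n (A i) i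

lemma IsStaircase.isLift_toCTFT {A : ℕ → ℤ} (hA : IsStaircase n A) : IsLift A hA.toCTFT :=
  ⟨hA, fun _ => rfl⟩

lemma IsLift.eq {A B : ℕ → ℤ} {T T' : CTFT n} (hA : IsLift A T) (hB : IsLift B T')
    (h : ∀ i ≤ n, A i = B i) : T = T' :=
  CTFT.ext_col <| funext fun i => by rw [hA.2, hB.2, h i (by omega)]

lemma IsLift.sub_period {A : ℕ → ℤ} {T : CTFT n} (hA : IsLift A T) (k : ℤ) :
    IsLift (fun i => A i - k * (n + 4)) T := by
  refine ⟨fun i hi => ?_, fun i => ?_⟩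
  · exact (hA.1 i hi).imp (fun h => by simp only [h]) fun h => by simp only [h]; ring
  · beta_reduce
    rw [hA.2, sub_eq_add_neg, ← neg_mul, arcChord_add_period]

/-- The next chord keeps one end of chord `k` and moves the other by one vertex, which leaves four
candidates. The two that shorten the arc are impossible: each is a side if `k = 0`, and otherwise
equals or crosses chord `k - 1`. -/
lemma exists_next_chord (T : CTFT n) {k : ℕ} (hk : k < n) {A : ℕ → ℤ}
    (hA : ∀ i < k, A (i + 1) = A i ∨ A (i + 1) = A i - 1)
    (hcol : ∀ i : Fin (n + 1), (i : ℕ) ≤ k → T.col i = arcChord n (A i) i) :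
    ∃ x : ℤ, (x = A k ∨ x = A k - 1) ∧
      T.col (⟨k, hk⟩ : Fin n).succ = arcChord n x (k + 1) := by
  set i : Fin n := ⟨k, hk⟩
  have hshrink₁ : T.col i.succ ≠ s(((A k + 1 : ℤ) : Vertex n), ((A k + k + 2 : ℤ) : Vertex n)) := by
    intro h
    have hch := (T.isTriangulation.1.1 _ (T.col_mem i.succ)).2
    rcases k with _ | k
    · exact hch (h ▸ isExternal_intCast (by push_cast; ring))
    · have hp := hcol ⟨k, by omega⟩ (by simp)
      simp only [arcChord] at hp
      rcases hA k (by omega) with hs | hs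
      · refine T.isTriangulation.1.2 _ (T.col_mem ⟨k, by omega⟩) _ (T.col_mem i.succ) ?_
        rw [hp, h]
        exact crosses_intCast (by omega) (by omega) (by omega) (by omega)
      · have := @T.isProperColoring.injective ⟨k, by omega⟩ i.succ (by
          rw [hp, h, hs]; congr 3 <;> push_cast <;> ring_nf)
        simp only [Fin.ext_iff, Fin.val_succ, i] at this
        omega
  have hshrink₂ : T.col i.succ ≠ s(((A k : ℤ) : Vertex n), ((A k + k + 1 : ℤ) : Vertex n)) := by
    intro h
    have hch := (T.isTriangulation.1.1 _ (T.col_mem i.succ)).2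
    rcases k with _ | k
    · exact hch (h ▸ isExternal_intCast (by push_cast; ring))
    · have hp := hcol ⟨k, by omega⟩ (by simp)
      simp only [arcChord] at hp
      rcases hA k (by omega) with hs | hs
      · have := @T.isProperColoring.injective ⟨k, by omega⟩ i.succ (by
          rw [hp, h, hs, show A k + (k + 1 : ℕ) + 1 = A k + k + 2 by push_cast; ring])
        simp only [Fin.ext_iff, Fin.val_succ, i] at this
        omega
      · refine T.isTriangulation.1.2 _ (T.col_mem i.succ) _ (T.col_mem ⟨k, by omega⟩) ?_
        rw [hp, h]
        exact crosses_intCast (by omega) (by omega) (by omega) (by omega)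
  obtain ⟨a, b, c, h₁, h₂, h₃⟩ := T.exists_col_eq i
  have hk' := hcol i.castSucc le_rfl
  rw [h₁] at hk'
  simp only [arcChord, Fin.val_castSucc, Sym2.eq_iff, i] at hk'
  rcases hk' with ⟨rfl, rfl⟩ | ⟨rfl, rfl⟩ <;> rcases h₃ with h₃ | rfl
  · refine ⟨A k - 1, Or.inr rfl, ?_⟩
    rw [h₂, arcChord, Sym2.eq_swap, ← sub_eq_of_eq_add h₃]
    congr 2 <;> push_cast <;> ring
  · refine absurd ?_ hshrink₁
    rw [h₂, Sym2.eq_swap]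
    push_cast
    rfl
  · refine absurd ?_ hshrink₂
    rw [h₂, ← sub_eq_of_eq_add h₃]
    congr 2
    push_cast
    ring
  · refine ⟨A k, Or.inl rfl, ?_⟩
    rw [h₂, arcChord]
    congr 2
    push_cast
    ring

lemma exists_isLift (T : CTFT n) : ∃ A, IsLift A T := by
  have key : ∀ k ≤ n, ∃ A : ℕ → ℤ, (∀ i < k, A (i + 1) = A i ∨ A (i + 1) = A i - 1) ∧
      ∀ i : Fin (n + 1), (i : ℕ) ≤ k → T.col i = arcChord n (A i) i := by
    intro k hk
    induction k with
    | zero =>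
      obtain ⟨v, hv⟩ := T.isProperColoring.short
      obtain ⟨x, rfl⟩ := ZMod.intCast_surjective v
      refine ⟨fun _ => x - 1, by simp, fun i hi => ?_⟩
      obtain rfl : i = 0 := Fin.ext (by simpa using hi)
      rw [hv, arcChord, Fin.val_zero]
      congr 2 <;> push_cast <;> ring
    | succ k ih =>
      obtain ⟨A, hA, hcol⟩ := ih (by omega)
      obtain ⟨x, hx, hcol'⟩ := exists_next_chord T (by omega) hA hcol
      refine ⟨Function.update A (k + 1) x, fun i hi => ?_, fun i hi => ?_⟩
      · rcases Nat.lt_succ_iff_lt_or_eq.1 hi with h | rfl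
        · rw [Function.update_of_ne (by omega), Function.update_of_ne (by omega)]
          exact hA i h
        · rwa [Function.update_self, Function.update_of_ne (by omega)]
      · rcases Nat.le_succ_iff.1 hi with h | h
        · rw [Function.update_of_ne (by omega)]
          exact hcol i h
        · rw [show i = (⟨k, by omega⟩ : Fin n).succ from Fin.ext h]
          simpa using hcol'
  obtain ⟨A, hA, hcol⟩ := key n le_rfl
  exact ⟨A, hA, fun i => hcol i (by omega)⟩

/-! ### Lower bound: lifting walks -/

/-- Staircases that encode the same chords except possibly for the label `i` differ, up to a
translation by a multiple of the period, by at most one at `i` and nowhere else. -/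
lemma exists_translate (hn : 3 ≤ n) {A C : ℕ → ℤ} (hA : IsStaircase n A) (hC : IsStaircase n C)
    {i : ℕ} (h : ∀ j ≤ n, j ≠ i → arcChord n (A j) j = arcChord n (C j) j) :
    ∃ k : ℤ, ∀ j ≤ n, |A j - (C j - k * (n + 4))| ≤ if j = i then 1 else 0 := by
  have hstep : ∀ j < n, |(C (j + 1) - A (j + 1)) - (C j - A j)| ≤ 1 := by
    intro j hj
    rw [abs_le]
    rcases hA j hj with h₁ | h₁ <;> rcases hC j hj with h₂ | h₂ <;> omega
  -- A chord can match with its ends exchanged only if `n + 4` divides `2j + 4`, that is, if it is a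
  -- diameter. For `j ≤ 1` this is excluded by `2j + 4 ≤ 6 < n + 4`, which is where `3 ≤ n` is
  -- needed.
  have hsmall : ∀ j ≤ 1, j ≠ i → (n + 4 : ℤ) ∣ C j - A j := by
    intro j hj hji
    rcases arcChord_eq_arcChord (h j (by omega) hji) with h | ⟨h₁, h₂⟩
    · exact h
    · have h₃ := dvd_sub h₁ h₂
      have := Int.le_of_dvd (by omega) h₃
      omega
  have htwice : ∀ j ≤ n, j ≠ i → (n + 4 : ℤ) ∣ 2 * (C j - A j) := by
    intro j hj hji
    rcases arcChord_eq_arcChord (h j hj hji) with h | ⟨h₁, h₂⟩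
    · exact h.mul_left 2
    · rw [show 2 * (C j - A j) = C j - A j + j + 2 + (C j - A j - j - 2) by ring]
      exact dvd_add h₁ h₂
  -- At least one of the labels `0`, `1` differs from `i` and fixes the translation. If both do, the
  -- step bound forces them to agree.
  obtain ⟨k, hk⟩ : ∃ k : ℤ, ∀ j ≤ 1, j ≠ i → C j - A j = k * (n + 4) := by
    by_cases hi : i = 0
    · obtain ⟨k, hk⟩ := hsmall 1 le_rfl (by omega)
      exact ⟨k, fun j hj hji => by obtain rfl : j = 1 := by omega
                                   rw [hk, mul_comm]⟩
    · obtain ⟨k, hk⟩ := hsmall 0 (by omega) (by omega)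
      refine ⟨k, fun j hj hji => ?_⟩
      rcases (by omega : j = 0 ∨ j = 1) with rfl | rfl
      · rw [hk, mul_comm]
      · obtain ⟨l, hl⟩ := hsmall 1 hj hji
        have h₀ := hstep 0 (by omega)
        have hd : (n + 4 : ℤ) ∣ (C (0 + 1) - A (0 + 1)) - (C 0 - A 0) := by
          rw [hk, hl]
          exact ⟨l - k, by ring⟩
        have := Int.eq_zero_of_abs_lt_dvd hd (by omega)
        rw [zero_add] at this
        linarith
  refine ⟨k, fun j hj => ?_⟩
  set D : ℕ → ℤ := fun j => A j - (C j - k * (n + 4)) with hD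
  have hDstep : ∀ j < n, |D (j + 1) - D j| ≤ 1 := by
    intro j hj
    have := hstep j hj
    rw [abs_le] at this ⊢
    simp only [hD]
    constructor <;> linarith
  -- Even for a diameter `n + 4` divides `2 * D j`, so small values vanish. The bound `2` allows for
  -- the deviation at `i` plus one step.
  have hzero : ∀ j ≤ n, j ≠ i → |D j| ≤ 2 → D j = 0 := by
    intro j hj hji h₂
    have hd : (n + 4 : ℤ) ∣ 2 * D j := by
      rw [show 2 * D j = (n + 4) * (2 * k) - 2 * (C j - A j) by simp only [hD]; ring]
      exact dvd_sub (dvd_mul_right _ _) (htwice j hj hji)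
    rw [abs_le] at h₂
    have := Int.eq_zero_of_abs_lt_dvd hd (by rw [abs_lt]; constructor <;> linarith)
    omega
  change |D j| ≤ _
  induction j with
  | zero =>
    split_ifs with hi
    · have h₁ := hk 1 le_rfl (by omega)
      have h₂ := hDstep 0 (by omega)
      have h₃ : D (0 + 1) = 0 := by simp only [hD, zero_add]; linarith
      rwa [h₃, zero_sub, abs_neg] at h₂
    · have h₁ := hk 0 (by omega) hi
      have h₂ : D 0 = 0 := by simp only [hD]; linarith
      simp [h₂]
  | succ j ih =>
    have h₀ := ih (by omega)
    have h₁ := hDstep j (by omega)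
    split_ifs with h₂
    · rw [if_neg (by omega), abs_nonpos_iff] at h₀
      rwa [h₀, sub_zero] at h₁
    · rw [hzero (j + 1) hj h₂, abs_zero]
      rw [abs_le] at h₁ ⊢
      split_ifs at h₀ <;> rw [abs_le] at h₀ <;> omega

lemma exists_col_eq_of_adj {T T' : CTFT n} (h : (flipGraph n).Adj T T') :
    ∃ i : Fin (n + 1), ∀ j ≠ i, T.col j = T'.col j := by
  rw [flipGraph, SimpleGraph.fromRel_adj] at h
  obtain ⟨-, ⟨i, _, _, _, _, -, -, -, -, h⟩ | ⟨i, _, _, _, _, -, -, -, -, h⟩⟩ := h <;>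
  exact ⟨i, fun j hj => by rw [h, Function.update_of_ne hj]⟩

/-- The `ℓ¹` distance between staircases. -/
def stairDist (n : ℕ) (A B : ℕ → ℤ) : ℤ :=
  ∑ i ∈ Finset.range (n + 1), |A i - B i|

lemma stairDist_comm (A B : ℕ → ℤ) : stairDist n A B = stairDist n B A :=
  Finset.sum_congr rfl fun _ _ => abs_sub_comm _ _

lemma stairDist_triangle (A B C : ℕ → ℤ) :
    stairDist n A C ≤ stairDist n A B + stairDist n B C := by
  rw [stairDist, stairDist, stairDist, ← Finset.sum_add_distrib]
  exact Finset.sum_le_sum fun _ _ => abs_sub_le _ _ _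

lemma exists_isLift_of_adj (hn : 3 ≤ n) {T T' : CTFT n} (h : (flipGraph n).Adj T T') {A : ℕ → ℤ}
    (hA : IsLift A T) : ∃ A', IsLift A' T' ∧ stairDist n A A' ≤ 1 := by
  obtain ⟨i, hi⟩ := exists_col_eq_of_adj h
  obtain ⟨C, hC⟩ := exists_isLift T'
  obtain ⟨k, hk⟩ := exists_translate hn hA.1 hC.1 (i := i) fun j hj hji => by
    have := hi ⟨j, by omega⟩ (fun h => hji (by simp [← h]))
    rwa [hA.2, hC.2] at this
  refine ⟨_, hC.sub_period k, ?_⟩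
  calc stairDist n A (fun j => C j - k * (n + 4))
      ≤ ∑ j ∈ Finset.range (n + 1), if j = i then (1 : ℤ) else 0 :=
        Finset.sum_le_sum fun j hj => hk j (by simpa [Nat.lt_succ_iff] using hj)
    _ ≤ 1 := by rw [Finset.sum_ite_eq']; split_ifs <;> norm_num

lemma exists_isLift_of_walk (hn : 3 ≤ n) {T T' : CTFT n} (p : (flipGraph n).Walk T T')
    {A : ℕ → ℤ} (hA : IsLift A T) : ∃ A', IsLift A' T' ∧ stairDist n A A' ≤ p.length := by
  induction p generalizing A with
  | nil => exact ⟨A, hA, by simp [stairDist]⟩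
  | cons h p ih =>
    obtain ⟨B, hB, hAB⟩ := exists_isLift_of_adj hn h hA
    obtain ⟨C, hC, hBC⟩ := ih hB
    refine ⟨C, hC, (stairDist_triangle A B C).trans ?_⟩
    rw [SimpleGraph.Walk.length_cons]
    push_cast
    linarith

lemma IsLift.exists_eq_sub_period (hn : 3 ≤ n) {T : CTFT n} {A B : ℕ → ℤ} (hA : IsLift A T)
    (hB : IsLift B T) : ∃ k : ℤ, ∀ j ≤ n, A j = B j - k * (n + 4) := by
  -- The label `n + 1` is out of range, so no entry is exceptional.
  obtain ⟨k, hk⟩ := exists_translate hn hA.1 hB.1 (i := n + 1) fun j hj _ => by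
    rw [← hA.2 ⟨j, by omega⟩, ← hB.2 ⟨j, by omega⟩]
  refine ⟨k, fun j hj => ?_⟩
  have := hk j hj
  rw [if_neg (by omega), abs_nonpos_iff] at this
  linarith

lemma le_length_of_sum_eq (hn : 3 ≤ n) {T T' : CTFT n} {A B : ℕ → ℤ} (hA : IsLift A T)
    (hB : IsLift B T')
    (hAB : 2 * ∑ i ∈ Finset.range (n + 1), (A i - B i) = (n + 1) * (n + 4))
    (p : (flipGraph n).Walk T T') : (n + 1) * (n + 4) ≤ 2 * p.length := by
  obtain ⟨C, hC, hAC⟩ := exists_isLift_of_walk hn p hA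
  obtain ⟨k, hk⟩ := hC.exists_eq_sub_period hn hB
  have h₁ : ∑ i ∈ Finset.range (n + 1), (A i - C i) =
      ∑ i ∈ Finset.range (n + 1), (A i - B i) + k * ((n + 1) * (n + 4)) := by
    rw [Finset.sum_congr rfl (g := fun i => A i - B i + k * (n + 4)), Finset.sum_add_distrib]
    · simp only [Finset.sum_const, Finset.card_range, nsmul_eq_mul]
      push_cast
      ring
    · intro i hi
      rw [hk i (by simpa [Nat.lt_succ_iff] using hi)]
      ring
  have h₂ : |∑ i ∈ Finset.range (n + 1), (A i - C i)| ≤ stairDist n A C :=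
    Finset.abs_sum_le_sum_abs _ _
  have h₃ := (abs_le.1 (h₂.trans hAC))
  zify
  have hpos : (0 : ℤ) ≤ (n + 1) * (n + 4) := by positivity
  -- The sum is `2k + 1` times half of `(n + 1)(n + 4)`, and an odd number has absolute value at
  -- least one.
  rcases le_or_gt 0 k with hk0 | hk0
  · nlinarith
  · nlinarith

/-! ### Upper bound: raising staircases -/

/-- If `A` is somewhere below `B`, it can be raised at a place where it is below `B`. -/
lemma IsStaircase.exists_raise {A B : ℕ → ℤ} (hA : IsStaircase n A) (hB : IsStaircase n B)
    (h : ∃ i ≤ n, A i < B i) :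
    ∃ i ≤ n, A i < B i ∧ (∀ j, j + 1 = i → A j = A i + 1) ∧ (i < n → A (i + 1) = A i) := by
  obtain ⟨i₀, h₀, h₀'⟩ := h
  -- Up to a constant, `2 * A i + i` is the sum of the lifted ends of chord `i`, and it changes by
  -- `±1` at each step. A neighbor with a smaller value would again lie below `B`, so a minimizer is
  -- a local minimum, where raising is allowed.
  obtain ⟨i, hi, hmin⟩ := Finset.exists_min_image
    ((Finset.range (n + 1)).filter fun i => A i < B i) (fun i => 2 * A i + i)
    ⟨i₀, by simp [h₀, h₀']⟩
  simp only [Finset.mem_filter, Finset.mem_range, Nat.lt_succ_iff] at hi hmin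
  refine ⟨i, hi.1, hi.2, ?_, ?_⟩
  · rintro j rfl
    have h₁ := hA j (by omega)
    have h₂ := hB j (by omega)
    have h₃ := hmin j
    push_cast at h₃
    omega
  · intro hin
    have h₁ := hA i hin
    have h₂ := hB i hin
    have h₃ := hmin (i + 1)
    push_cast at h₃
    omega

lemma IsStaircase.update {A : ℕ → ℤ} (hA : IsStaircase n A) {i : ℕ}
    (hl : ∀ j, j + 1 = i → A j = A i + 1) (hr : i < n → A (i + 1) = A i) :
    IsStaircase n (Function.update A i (A i + 1)) := by
  intro j hj
  rcases eq_or_ne (j + 1) i with rfl | h₁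
  · rw [Function.update_self, Function.update_of_ne (by omega), hl j rfl]
    exact Or.inl rfl
  · rcases eq_or_ne j i with rfl | h₂
    · rw [Function.update_self, Function.update_of_ne (by omega), hr hj]
      exact Or.inr (by ring)
    · rw [Function.update_of_ne h₁, Function.update_of_ne h₂]
      exact hA j hj

/-- Raising a staircase amounts to a flip. -/
lemma isFlip_raise {A A' : ℕ → ℤ} {T T' : CTFT n} (hA : IsLift A T) (hA' : IsLift A' T')
    (i : Fin (n + 1)) (hl : ∀ j, j + 1 = (i : ℕ) → A j = A i + 1)
    (hr : (i : ℕ) < n → A (i + 1) = A i) (h : A' = Function.update A i (A i + 1)) :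
    IsFlip i T T' := by
  have hcol (j : Fin (n + 1)) : IsEdge T.chords (arcChord n (A j) j) :=
    Or.inl (hA.2 j ▸ T.col_mem j)
  have hi := hcol i
  rw [arcChord] at hi
  refine ⟨(A i : ℤ), ((A i + 1 : ℤ) : Vertex n), ((A i + i + 2 : ℤ) : Vertex n),
    ((A i + i + 3 : ℤ) : Vertex n), ?_, ⟨Or.inr (isExternal_intCast rfl), ?_, Sym2.eq_swap ▸ hi⟩,
    ⟨?_, Or.inr ?_, Sym2.eq_swap ▸ hi⟩, ?_, ?_⟩
  · intro h
    have := intCast_inj_of_lt h (by omega) (by omega)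
    omega
  · obtain ⟨_ | j, hj⟩ := i
    · exact Or.inr (isExternal_intCast (by push_cast; ring))
    · have := hcol ⟨j, by omega⟩
      simp only [hl j rfl, arcChord] at this
      rwa [show A (j + 1) + 1 + j + 2 = A (j + 1) + (j + 1 : ℕ) + 2 by push_cast; ring] at this
  · rcases (Nat.lt_succ_iff.1 i.isLt).lt_or_eq with h | h
    · have := hcol ⟨i + 1, by omega⟩
      simp only [hr h, arcChord] at this
      rwa [show A i + (i + 1 : ℕ) + 2 = A i + i + 3 by push_cast; ring] at this
    · rw [h]
      exact Or.inr (isExternal_intCast_period _)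
  · rw [Sym2.eq_swap]
    exact isExternal_intCast (by ring)
  · rw [hA.2, arcChord]
  · funext j
    rcases eq_or_ne j i with rfl | hj
    · rw [hA'.2, h, Function.update_self, Function.update_self, arcChord]
      rw [show A j + 1 + j + 2 = A j + j + 3 by ring]
    · rw [hA'.2, h, Function.update_of_ne hj, hA.2,
        Function.update_of_ne (fun h => hj (Fin.ext h))]

lemma edist_le_one_of_isFlip {T T' : CTFT n} {i : Fin (n + 1)} (h : IsFlip i T T') :
    (flipGraph n).edist T T' ≤ 1 := by
  rw [SimpleGraph.edist_le_one_iff_adj_or_eq, flipGraph, SimpleGraph.fromRel_adj]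
  by_cases hT : T = T'
  · exact Or.inr hT
  · exact Or.inl ⟨hT, Or.inl ⟨i, h⟩⟩

lemma stairDist_update {A B : ℕ → ℤ} {i : ℕ} (hi : i ≤ n) (h : A i < B i) :
    stairDist n (Function.update A i (A i + 1)) B = stairDist n A B - 1 := by
  have hmem : i ∈ Finset.range (n + 1) := by simpa [Nat.lt_succ_iff] using hi
  rw [stairDist, stairDist, ← Finset.add_sum_erase _ _ hmem, ← Finset.add_sum_erase _ _ hmem,
    Function.update_self, abs_of_neg (show A i - B i < 0 by linarith),
    abs_of_nonpos (show A i + 1 - B i ≤ 0 by linarith),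
    Finset.sum_congr rfl fun j hj => by rw [Function.update_of_ne (Finset.ne_of_mem_erase hj)]]
  ring

lemma edist_le_of_stairDist_le (m : ℕ) {T T' : CTFT n} {A B : ℕ → ℤ} (hA : IsLift A T)
    (hB : IsLift B T') (h : stairDist n A B ≤ m) : (flipGraph n).edist T T' ≤ m := by
  induction m generalizing T T' A B with
  | zero =>
    have h₀ : stairDist n A B = 0 :=
      le_antisymm (by simpa using h) (Finset.sum_nonneg fun _ _ => abs_nonneg _)
    rw [stairDist, Finset.sum_eq_zero_iff_of_nonneg fun _ _ => abs_nonneg _] at h₀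
    rw [hA.eq hB fun i hi => sub_eq_zero.1 (abs_eq_zero.1 (h₀ i (by simp; omega)))]
    simp
  | succ m ih =>
    by_cases hAB : ∀ i ≤ n, A i = B i
    · rw [hA.eq hB hAB]
      simp
    push Not at hAB
    obtain ⟨i₀, h₀, h₀'⟩ := hAB
    wlog hlt : A i₀ < B i₀ generalizing T T' A B
    · rw [SimpleGraph.edist_comm]
      exact this hB hA (by rwa [stairDist_comm]) h₀'.symm (by omega)
    obtain ⟨i, hi, hi', hl, hr⟩ := hA.1.exists_raise hB.1 ⟨i₀, h₀, hlt⟩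
    have hA' := (hA.1.update hl hr).isLift_toCTFT
    have h₁ := edist_le_one_of_isFlip
      (isFlip_raise hA hA' ⟨i, by omega⟩ hl hr rfl)
    have h₂ := ih hA' hB (by rw [stairDist_update hi hi']; push_cast at h; linarith)
    calc _ ≤ _ := SimpleGraph.edist_triangle
      _ ≤ 1 + (m : ℕ∞) := add_le_add h₁ h₂
      _ = _ := by push_cast; rw [add_comm]

lemma abs_sub_le_of_step {D : ℕ → ℤ} (hD : ∀ i < n, |D (i + 1) - D i| ≤ 1) {i j : ℕ}
    (hij : i ≤ j) (hj : j ≤ n) : |D j - D i| ≤ j - i := by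
  induction j, hij using Nat.le_induction with
  | base => simp
  | succ j hij ih =>
    have h₁ := ih (by omega)
    have h₂ := hD j (by omega)
    rw [abs_le] at *
    push_cast
    omega

/-- A sequence with steps at most one is, after a suitable translation by a multiple of `n + 4`,
at most `(n + 4) / 2` in absolute value on average. -/
lemma exists_sum_abs_sub_le {D : ℕ → ℤ} (hD : ∀ i < n, |D (i + 1) - D i| ≤ 1) :
    ∃ k : ℤ, 2 * ∑ i ∈ Finset.range (n + 1), |D i - k * (n + 4)| ≤ (n + 1) * (n + 4) := by
  have hconst (c : ℤ) : ∑ _i ∈ Finset.range (n + 1), c = (n + 1) * c := by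
    simp
  by_cases hz : ∃ j ≤ n, ∃ k : ℤ, D j = k * (n + 4)
  · obtain ⟨j, hj, k, hk⟩ := hz
    refine ⟨k, ?_⟩
    have h₁ : ∀ i ≤ n, |D i - k * (n + 4)| ≤ |(i : ℤ) - j| := by
      intro i hi
      rw [← hk]
      rcases le_total i j with h | h
      · rw [abs_sub_comm, abs_sub_comm (i : ℤ)]
        exact (abs_sub_le_of_step hD h hj).trans (le_abs_self _)
      · exact (abs_sub_le_of_step hD h hi).trans (le_abs_self _)
    -- Pairing `i` with `n - i` works because `|i - j| + |n - i - j| ≤ n` for `0 ≤ i, j ≤ n`.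
    calc _ = ∑ i ∈ Finset.range (n + 1), |D i - k * (n + 4)|
            + ∑ i ∈ Finset.range (n + 1), |D (n + 1 - 1 - i) - k * (n + 4)| := by
          rw [Finset.sum_range_reflect (fun i => |D i - k * (n + 4)|) (n + 1), two_mul]
      _ ≤ ∑ _i ∈ Finset.range (n + 1), (n + 4 : ℤ) := by
          rw [← Finset.sum_add_distrib]
          refine Finset.sum_le_sum fun i hi => ?_
          rw [Finset.mem_range, Nat.lt_succ_iff] at hi
          have h₂ := h₁ i hi
          have h₃ := h₁ (n + 1 - 1 - i) (by omega)
          push_cast [Nat.add_sub_cancel, Nat.cast_sub hi] at h₃ ⊢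
          refine (add_le_add h₂ h₃).trans ?_
          rcases abs_cases ((i : ℤ) - j) with h₄ | h₄ <;>
          rcases abs_cases ((n : ℤ) - i - j) with h₅ | h₅ <;> omega
      _ = _ := hconst _
  · push Not at hz
    set k := D 0 / (n + 4) with hk
    have h₀ : 0 < D 0 - k * (n + 4) ∧ D 0 - k * (n + 4) < n + 4 := by
      have h₁ := Int.emod_nonneg (D 0) (show (n + 4 : ℤ) ≠ 0 by omega)
      have h₂ := Int.emod_lt_of_pos (D 0) (show (0 : ℤ) < n + 4 by omega)
      have h₃ := hz 0 (by omega) k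
      have h₄ := Int.emod_add_mul_ediv (D 0) (n + 4)
      rw [← hk, mul_comm] at h₄
      omega
    -- Steps of size one cannot jump over a multiple of `n + 4`. The distances to the two enclosing
    -- multiples then add up to `n + 4`, so one of these multiples is good enough on average.
    have h₁ : ∀ i ≤ n, 0 < D i - k * (n + 4) ∧ D i - k * (n + 4) < n + 4 := by
      intro i hi
      induction i with
      | zero => exact h₀
      | succ i ih =>
        have h₂ := ih (by omega)
        have h₃ := abs_le.1 (hD i (by omega))
        have h₄ := hz (i + 1) hi k
        have h₅ := hz (i + 1) hi (k + 1)
        rw [add_mul, one_mul] at h₅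
        omega
    have h₂ : ∑ i ∈ Finset.range (n + 1), |D i - k * (n + 4)|
        + ∑ i ∈ Finset.range (n + 1), |D i - (k + 1) * (n + 4)| = (n + 1) * (n + 4) := by
      rw [← Finset.sum_add_distrib, ← hconst]
      refine Finset.sum_congr rfl fun i hi => ?_
      obtain ⟨h₃, h₄⟩ := h₁ i (by simpa [Nat.lt_succ_iff] using hi)
      rw [abs_of_pos h₃, abs_of_neg (by linarith)]
      ring
    rcases le_total (∑ i ∈ Finset.range (n + 1), |D i - k * (n + 4)|)
      (∑ i ∈ Finset.range (n + 1), |D i - (k + 1) * (n + 4)|) with h | h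
    · exact ⟨k, by linarith⟩
    · exact ⟨k + 1, by linarith⟩

lemma edist_flipGraph_le (T T' : CTFT n) :
    (flipGraph n).edist T T' ≤ (((n + 1) * (n + 4) / 2 : ℕ) : ℕ∞) := by
  obtain ⟨A, hA⟩ := exists_isLift T
  obtain ⟨B, hB⟩ := exists_isLift T'
  obtain ⟨k, hk⟩ := exists_sum_abs_sub_le (n := n) (D := fun i => A i - B i) fun i hi => by
    have h₁ := hA.1 i hi
    have h₂ := hB.1 i hi
    rw [abs_le]
    omega
  refine edist_le_of_stairDist_le _ (hA.sub_period k) hB ?_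
  have h₁ : stairDist n (fun i => A i - k * (n + 4)) B =
      ∑ i ∈ Finset.range (n + 1), |A i - B i - k * (n + 4)| :=
    Finset.sum_congr rfl fun i _ => by rw [sub_right_comm]
  rw [h₁]
  push_cast
  omega

/-! ### The diameter -/

lemma isStaircase_step {m : ℕ} {c d : ℤ} (h : d = c ∨ d = c - 1) :
    IsStaircase n fun i => if i < m then c else d := by
  intro i _
  simp only
  split_ifs <;> omega

lemma exists_staircases_sum_eq (n : ℕ) : ∃ A B : ℕ → ℤ, IsStaircase n A ∧ IsStaircase n B ∧
    2 * ∑ i ∈ Finset.range (n + 1), (A i - B i) = (n + 1) * (n + 4) := by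
  -- The difference must average `(n + 4) / 2`. It is constant for even `n`; for odd `n` each of the
  -- two nearest integers is taken on half of the labels.
  rcases Nat.even_or_odd' n with ⟨m, rfl | rfl⟩
  · refine ⟨fun _ => m + 2, fun _ => 0, fun _ _ => Or.inl rfl, fun _ _ => Or.inl rfl, ?_⟩
    simp only [sub_zero, Finset.sum_const, Finset.card_range, nsmul_eq_mul]
    push_cast
    ring
  · refine ⟨fun i => if i < m + 1 then (m + 3 : ℤ) else m + 2, fun _ => 0,
      isStaircase_step (Or.inr (by ring)), fun _ _ => Or.inl rfl, ?_⟩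
    rw [show 2 * m + 1 + 1 = (m + 1) + (m + 1) by ring, Finset.sum_range_add,
      Finset.sum_congr rfl (g := fun _ => (m + 3 : ℤ)), Finset.sum_congr rfl (s₁ := Finset.range
        (m + 1)) (f := fun x => (if m + 1 + x < m + 1 then (m + 3 : ℤ) else m + 2) - 0)
        (g := fun _ => (m + 2 : ℤ))]
    · simp only [Finset.sum_const, Finset.card_range, nsmul_eq_mul]
      push_cast
      ring
    · intro i _
      rw [if_neg (by omega), sub_zero]
    · intro i hi
      simp [Finset.mem_range.1 hi]

end TriangleFree

theorem theorem5p1 (n : ℕ) (hn : 3 ≤ n) :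
    (TriangleFree.flipGraph n).ediam = (((n + 1) * (n + 4) / 2 : ℕ) : ℕ∞) := by
  refine le_antisymm (SimpleGraph.ediam_le_of_edist_le TriangleFree.edist_flipGraph_le) ?_
  obtain ⟨A, B, hA, hB, hAB⟩ := TriangleFree.exists_staircases_sum_eq n
  refine le_trans ?_ (SimpleGraph.edist_le_ediam (u := hA.toCTFT) (v := hB.toCTFT))
  rw [SimpleGraph.edist]
  refine le_iInf fun p => ?_
  have := TriangleFree.le_length_of_sum_eq hn hA.isLift_toCTFT hB.isLift_toCTFT hAB p
  norm_cast
  omega
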